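/- Let $q$ be a power of an odd prime and $n\ge 0$. For $1\le i\le n$ put $\bar i=n+1-i$. **The groups.** Let $G=UT_n(\mathbb F_{q^2})$ be the group of upper triangular $n\times n$ matrices over $\mathbb F_{q^2}$ with ones on the diagonal, and let $\mathfrak g=\mathfrak{ut}_n(\mathbb F_{q^2})$ be the algebra of strictly upper triangular matrices. For an $n\times n$ matrix $x$ over $\mathbb F_{q^2}$ let $x^\dagger=J\overline{x}^{\,t}J$, where $\overline{x}$ is obtained from $x$ by raising every entry to the $q$-th power and $J$ is the matrix with ones on the antidiagonal and zeroes elsewhere. Let $$U=UU_n(\mathbb F_{q^2})=\{u\in G: u^{-1}=u^\dagger\},\qquad \mathfrak u=\{x\in\mathfrak g: x^\dagger=-x\},$$ so that $U$ is a group and $\mathfrak u$ an $\mathbb F_q$-vector space. The group $G$ acts on $\mathfrak u$ by $g\cdot x=gxg^\dagger$ and on the dual space $\mathfrak u^*=\mathrm{Hom}_{\mathbb F_q}(\mathfrak u,\mathbb F_q)$ by $(g\cdot\lambda)(x)=\lambda(g^{-1}\cdot x)$. Let $H$ be the subgroup of $G$ of all $1+x$ with $x\in\mathfrak g$ and $x_{ij}=0$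 whenever $j\le n/2$. **Supercharacters.** Let $f:G\to\mathfrak g$ be a Springer morphism: a bijection with $f(U)=\mathfrak u$ for which there are $a_i\in\mathbb F_q$ with $f(1+x)=x+\sum_{i\ge 2}a_ix^i$ for all $x\in\mathfrak g$. Let $\theta:\mathbb F_q^+\to\mathbb C^\times$ be a nontrivial homomorphism. For $\lambda\in\mathfrak u^*$ let $\chi_\lambda:U\to\mathbb C$ be $$\chi_\lambda(u)=\frac{|H\cdot\lambda|}{|G\cdot\lambda|}\sum_{\mu\in G\cdot\lambda}\theta\bigl(\mu(f(u))\bigr).$$ **Twisted set partitions.** An $\mathbb F_{q^2}$-set partition of $\{1,\dots,n\}$ is a set $\eta$ of arcs $i\overset{a}{\frown}j$ with $i<j$ and labels $a\in\mathbb F_{q^2}^\times$ such that no two different arcs have the same left end or the same right end. It is a twisted $\mathbb F_q$-set partition if $i\overset{a}{\frown}j\in\eta$ implies $\bar j\overset{-a^q}{\frown}\bar i\in\eta$. Write $i\frown j\in\eta$ if $i\overset{a}{\frown}j\in\eta$ for some $a$. For a twisted $\mathbb F_q$-set partition $\eta$ let $x_\eta\in\mathfrak u$ be the matrix with $(i,j)$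 entry $a$ if $i\overset{a}{\frown}j\in\eta$ and $0$ if $i\frown j\notin\eta$, let $u_\eta\in U$ be the element with $f(u_\eta)=x_\eta$, let $\lambda_\eta\in\mathfrak u^*$ be given by $\lambda_\eta(x)=\sum_{i\overset{a}{\frown}j\in\eta}a\,x_{ij}$ (this lies in $\mathbb F_q$), and let $\chi^\eta=\chi_{\lambda_\eta}$. **Theorem.** Let $\eta$ and $\nu$ be twisted $\mathbb F_q$-set partitions of $\{1,\dots,n\}$. Then the sum $\sum ab$ over all pairs $i<j$ with $i\overset{a}{\frown}j\in\eta$ and $i\overset{b}{\frown}j\in\nu$ lies in $\mathbb F_q$, and $$\chi^\eta(u_\nu)=\begin{cases}\dfrac{\chi^\eta(1)}{(-q)^{\mathrm{nst}^\eta_\nu}}\;\theta\Bigl(\displaystyle\sum_{i\overset{a}{\frown}j\in\eta,\ i\overset{b}{\frown}j\in\nu}ab\Bigr)&\text{if } i\frown k\notin\nu \text{ and } k\frown j\notin\nu \text{ for all } i\frown j\in\eta \text{ and } i<k<j,\\[2ex]0&\text{otherwise,}\end{cases}$$ where $\mathrm{nst}^\eta_\nu=|\{i<j<k<l : j\frown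 k\in\nu,\ i\frown l\in\eta\}|$. -/

import Mathlib

namespace UnipotentUnitary

/-! Throughout, `F` is the field with `q = Fintype.card F` elements and `K` is a quadratic
extension of `F`, that is, the field with `q ^ 2` elements. Indices `1, …, n` are replaced by
`Fin n`, and `n + 1 - i` becomes `i.rev`. -/

section Field

variable {F K : Type*} [Field F] [Fintype F] [Field K] [Algebra F K]

theorem pow_card_pow_card [Algebra.IsQuadraticExtension F K] (a : K) :
    (a ^ Fintype.card F) ^ Fintype.card F = a := by
  have : Finite K := Module.finite_of_finite F
  have : Fintype K := Fintype.ofFinite K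
  have h : Fintype.card K = Fintype.card F ^ 2 := by
    rw [Module.card_eq_pow_finrank (K := F) (V := K),
      Algebra.IsQuadraticExtension.finrank_eq_two F K]
  rw [← pow_mul, ← pow_two, ← h, FiniteField.pow_card]

variable (F) in
theorem exists_algebraMap_of_pow_card (a : K) (ha : a ^ Fintype.card F = a) :
    ∃ c : F, algebraMap F K c = a := by
  classical
  have h0 : (Polynomial.X ^ Fintype.card F - Polynomial.X : Polynomial K) ≠ 0 :=
    FiniteField.X_pow_card_sub_X_ne_zero K Fintype.one_lt_card
  have hsub : Finset.univ.image (algebraMap F K) ⊆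
      (Polynomial.X ^ Fintype.card F - Polynomial.X : Polynomial K).roots.toFinset := by
    intro y hy
    obtain ⟨c, -, rfl⟩ := Finset.mem_image.1 hy
    simp [h0, ← map_pow, FiniteField.pow_card]
  have hcard : (Polynomial.X ^ Fintype.card F - Polynomial.X : Polynomial K).roots.toFinset.card
      ≤ (Finset.univ.image (algebraMap F K)).card := by
    rw [Finset.card_image_of_injective _ (algebraMap F K).injective, Finset.card_univ]
    refine (Multiset.toFinset_card_le _).trans ((Polynomial.card_roots' _).trans ?_)
    rw [FiniteField.X_pow_card_sub_X_natDegree_eq K Fintype.one_lt_card]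
  have heq := Finset.eq_of_subset_of_card_le hsub hcard
  have : a ∈ (Polynomial.X ^ Fintype.card F - Polynomial.X : Polynomial K).roots.toFinset := by
    simp [h0, ha]
  rw [← heq] at this
  obtain ⟨c, -, hc⟩ := Finset.mem_image.1 this
  exact ⟨c, hc⟩

end Field

set_option linter.unusedSectionVars false

section Groups

variable (n : ℕ) (F K : Type*) [Field F] [Fintype F] [Field K] [Algebra F K]

/-- The algebra `𝔲𝔱ₙ(K)` of strictly upper triangular matrices. -/
def ut : Submodule K (Matrix (Fin n) (Fin n) K) where
  carrier := {x | ∀ i j, j ≤ i → x i j = 0}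
  add_mem' := fun {x y} hx hy i j h => by simp [hx i j h, hy i j h]
  zero_mem' := fun i j _ => rfl
  smul_mem' := fun c x hx i j h => by simp [hx i j h]

/-- The group `UTₙ(K)` of upper triangular matrices with ones on the diagonal. -/
def UT : Subgroup (Matrix.GeneralLinearGroup (Fin n) K) where
  carrier := {g | (∀ i j, j < i → g.1 i j = 0) ∧ ∀ i, g.1 i i = 1}
  mul_mem' := by
    rintro g h ⟨hg, hg'⟩ ⟨hh, hh'⟩
    refine ⟨fun i j hij => ?_, fun i => ?_⟩
    · rw [Units.val_mul, Matrix.mul_apply]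
      refine Finset.sum_eq_zero fun k _ => ?_
      rcases lt_or_ge k i with hk | hk
      · rw [hg i k hk, zero_mul]
      · rw [hh k j (lt_of_lt_of_le hij hk), mul_zero]
    · rw [Units.val_mul, Matrix.mul_apply, Finset.sum_eq_single i]
      · rw [hg', hh', one_mul]
      · intro k _ hk
        rcases lt_or_gt_of_ne hk with hk | hk
        · rw [hg i k hk, zero_mul]
        · rw [hh k i hk, mul_zero]
      · intro h; exact absurd (Finset.mem_univ i) h
  one_mem' := ⟨fun i j h => by simp [h.ne'], fun i => by simp⟩
  inv_mem' := by
    rintro g ⟨hg, hg'⟩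
    have hT : ∀ i j, j < i → (g⁻¹).1 i j = 0 := by
      intro i j hij
      have : Invertible g.1 := g.invertible
      have hb : Matrix.BlockTriangular g.1 id := fun a b hab => hg a b hab
      have h2 := Matrix.blockTriangular_inv_of_blockTriangular hb
      rw [Matrix.coe_units_inv]
      exact h2 hij
    refine ⟨hT, fun i => ?_⟩
    have h1 : ((g⁻¹).1 * g.1) i i = 1 := by rw [Units.inv_mul]; simp
    rw [Matrix.mul_apply, Finset.sum_eq_single i] at h1
    · rwa [hg', mul_one] at h1
    · intro k _ hk
      rcases lt_or_gt_of_ne hk with hk | hk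
      · rw [hT i k hk, zero_mul]
      · rw [hg k i hk, mul_zero]
    · intro h; exact absurd (Finset.mem_univ i) h

/-- The subgroup `H` of `UTₙ(K)` of the elements `1 + x` such that the `j`-th column of `x` is
zero for all `j ≤ n / 2` (with columns numbered from `1` to `n`). -/
def colSubgroup : Subgroup (UT n K) where
  carrier := {h | ∀ j : Fin n, 2 * (j.1 + 1) ≤ n →
    ∀ i, h.1.1 i j = (1 : Matrix (Fin n) (Fin n) K) i j}
  mul_mem' := by
    intro g h hg hh j hj i
    rw [Subgroup.coe_mul, Units.val_mul, Matrix.mul_apply]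
    simp only [hh j hj]
    simpa [Matrix.one_apply] using hg j hj i
  one_mem' := fun j _ i => rfl
  inv_mem' := by
    intro g hg j hj i
    have h1 : ((g⁻¹).1.1 * g.1.1) i j = (1 : Matrix (Fin n) (Fin n) K) i j := by
      rw [Subgroup.coe_inv, Units.inv_mul]
    rw [Matrix.mul_apply] at h1
    simp only [hg j hj] at h1
    rw [← h1]
    simp [Matrix.one_apply]

variable {n K}

/-- The matrix with ones on the antidiagonal and zeroes elsewhere. -/
def antidiag : Matrix (Fin n) (Fin n) K := Matrix.of fun i j => if j = i.rev then 1 else 0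

/-- The antiautomorphism `x† = J x̄ᵗ J`, where the bar raises every entry to the `q`-th power. -/
def dagger (x : Matrix (Fin n) (Fin n) K) : Matrix (Fin n) (Fin n) K :=
  antidiag * (x.map fun a => a ^ Fintype.card F).transpose * antidiag

theorem dagger_apply (x : Matrix (Fin n) (Fin n) K) (i j : Fin n) :
    dagger F x i j = x j.rev i.rev ^ Fintype.card F := by
  have h : ∀ k : Fin n, (j = k.rev) ↔ (k = j.rev) := fun k => by
    constructor <;> (intro h; simp [h])
  simp [dagger, antidiag, Matrix.mul_apply, h]

theorem dagger_add (x y : Matrix (Fin n) (Fin n) K) :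
    dagger F (x + y) = dagger F x + dagger F y := by
  ext i j
  simpa [dagger_apply] using map_add (FiniteField.frobeniusAlgHom F K) (x j.rev i.rev)
    (y j.rev i.rev)

theorem dagger_smul (c : F) (x : Matrix (Fin n) (Fin n) K) :
    dagger F (c • x) = c • dagger F x := by
  ext i j
  have h := map_smul (FiniteField.frobeniusAlgHom F K) c (x j.rev i.rev)
  rw [FiniteField.coe_frobeniusAlgHom] at h
  rw [Matrix.smul_apply, dagger_apply, dagger_apply]
  exact h

theorem dagger_mul (x y : Matrix (Fin n) (Fin n) K) :
    dagger F (x * y) = dagger F y * dagger F x := by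
  ext i j
  have h := map_sum (FiniteField.frobeniusAlgHom F K)
    (fun k => x j.rev k * y k i.rev) Finset.univ
  simp only [FiniteField.coe_frobeniusAlgHom, mul_pow] at h
  rw [dagger_apply, Matrix.mul_apply, Matrix.mul_apply, h]
  refine Fintype.sum_equiv Fin.revPerm _ _ fun k => ?_
  simp [dagger_apply, mul_comm]

theorem dagger_one : dagger F (1 : Matrix (Fin n) (Fin n) K) = 1 := by
  ext i j
  rcases eq_or_ne i j with rfl | h
  · simp [dagger_apply]
  · have : j.rev ≠ i.rev := fun h' => h (Fin.rev_injective h').symm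
    simp [dagger_apply, h, this, Fintype.card_ne_zero]

theorem dagger_dagger [Algebra.IsQuadraticExtension F K] (x : Matrix (Fin n) (Fin n) K) :
    dagger F (dagger F x) = x := by
  ext i j
  simp [dagger_apply, pow_card_pow_card]

variable (n K)

/-- The group `UUₙ(K)` of unipotent unitary matrices: the `u` in `UTₙ(K)` with `u⁻¹ = u†`. -/
def UU : Subgroup (UT n K) where
  carrier := {u | (u⁻¹).1.1 = dagger F u.1.1}
  mul_mem' := by
    intro u v hu hv
    simp only [Set.mem_ofPred_eq] at hu hv ⊢
    rw [mul_inv_rev, Subgroup.coe_mul, Units.val_mul, hu, hv, Subgroup.coe_mul, Units.val_mul,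
      dagger_mul]
  one_mem' := by
    simp only [Set.mem_ofPred_eq, inv_one, Subgroup.coe_one, Units.val_one, dagger_one]
  inv_mem' := by
    intro u hu
    simp only [Set.mem_ofPred_eq] at hu ⊢
    rw [inv_inv]
    have h1 : dagger F (u⁻¹).1.1 * (u⁻¹).1.1 = 1 := by
      rw [hu, ← dagger_mul, ← hu]
      rw [Subgroup.coe_inv, Units.mul_inv, dagger_one]
    calc u.1.1 = dagger F (u⁻¹).1.1 * (u⁻¹).1.1 * u.1.1 := by rw [h1, one_mul]
      _ = dagger F (u⁻¹).1.1 := by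
        rw [mul_assoc, Subgroup.coe_inv, Units.inv_mul, mul_one]

/-- The `F`-vector space `𝔲𝔲ₙ(K)` of the `x` in `𝔲𝔱ₙ(K)` with `x† = -x`. -/
def uu : Submodule F (Matrix (Fin n) (Fin n) K) where
  carrier := {x | x ∈ ut n K ∧ dagger F x = -x}
  add_mem' := by
    rintro x y ⟨hx, hx'⟩ ⟨hy, hy'⟩
    exact ⟨add_mem hx hy, by rw [dagger_add, hx', hy', neg_add]⟩
  zero_mem' := ⟨zero_mem _, by ext i j; simp [dagger_apply, Fintype.card_ne_zero]⟩
  smul_mem' := by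
    rintro c x ⟨hx, hx'⟩
    refine ⟨fun i j h => ?_, by rw [dagger_smul, hx', smul_neg]⟩
    rw [Matrix.smul_apply, hx i j h, smul_zero]

variable {n F K}

theorem conj_mem_uu [Algebra.IsQuadraticExtension F K] (g : UT n K)
    {x : Matrix (Fin n) (Fin n) K} (hx : x ∈ uu n F K) :
    g.1.1 * x * dagger F g.1.1 ∈ uu n F K := by
  obtain ⟨hx, hx'⟩ := hx
  refine ⟨fun i j hij => ?_, ?_⟩
  · rw [Matrix.mul_apply]
    refine Finset.sum_eq_zero fun l _ => ?_
    rcases lt_or_ge j l with hl | hl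
    · rw [dagger_apply, g.2.1 _ _ (Fin.rev_lt_rev.2 hl), zero_pow Fintype.card_ne_zero, mul_zero]
    · rw [Matrix.mul_apply, Finset.sum_eq_zero, zero_mul]
      intro k _
      rcases lt_or_ge k i with hk | hk
      · rw [g.2.1 i k hk, zero_mul]
      · rw [hx k l (hl.trans (hij.trans hk)), mul_zero]
  · rw [dagger_mul, dagger_mul, dagger_dagger, hx', Matrix.neg_mul, Matrix.mul_neg,
      ← Matrix.mul_assoc]

variable (n F K)

/-- The action `g · x = g x g†` of `UTₙ(K)` on `𝔲𝔲ₙ(K)`. The action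
`(g · μ)(x) = μ(g⁻¹ · x)` on the dual space is `(act n F K).dual`. -/
def act [Algebra.IsQuadraticExtension F K] : Representation F (UT n K) (uu n F K) where
  toFun g :=
    { toFun := fun x => ⟨g.1.1 * x.1 * dagger F g.1.1, conj_mem_uu g x.2⟩
      map_add' := fun x y => Subtype.ext (by simp [Matrix.mul_add, Matrix.add_mul])
      map_smul' := fun c x => Subtype.ext (by simp) }
  map_one' := by
    ext x : 2
    simp [dagger_one]
  map_mul' g h := by
    ext x : 2
    simp [dagger_mul, Matrix.mul_assoc]

/-- A Springer morphism: a bijection `f : UTₙ(K) → 𝔲𝔱ₙ(K)` that maps `UUₙ(K)` onto `𝔲𝔲ₙ(K)` and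
is of the form `f (1 + x) = x + ∑ i ≥ 2, aᵢ xⁱ` with coefficients `aᵢ` in `F`. As `xⁿ = 0` for all
strictly upper triangular `x`, the sum may be cut off at `i = n`. -/
structure SpringerMorphism where
  toEquiv : UT n K ≃ ut n K
  image_UU : (fun u => (toEquiv u).1) '' (UU n F K : Set (UT n K)) = (uu n F K : Set _)
  exists_coeff : ∃ a : ℕ → F, ∀ g : UT n K, (toEquiv g).1 =
    (g.1.1 - 1) + ∑ i ∈ Finset.Icc 2 n, a i • (g.1.1 - 1) ^ i

variable {n F K}

/-- The restriction of a Springer morphism to a map from `UUₙ(K)` to `𝔲𝔲ₙ(K)`. -/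
def SpringerMorphism.restrict (f : SpringerMorphism n F K) (u : UU n F K) : uu n F K :=
  ⟨(f.toEquiv u.1).1, by
    have h : (f.toEquiv u.1).1 ∈ (uu n F K : Set _) := by
      rw [← f.image_UU]; exact ⟨u.1, u.2, rfl⟩
    exact h⟩

/-- The element of `UUₙ(K)` that a Springer morphism maps to a given element of `𝔲𝔲ₙ(K)`. -/
def SpringerMorphism.preimage (f : SpringerMorphism n F K) (x : uu n F K) : UU n F K :=
  ⟨f.toEquiv.symm ⟨x.1, x.2.1⟩, by
    have h : x.1 ∈ (fun u => (f.toEquiv u).1) '' (UU n F K : Set (UT n K)) := by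
      rw [f.image_UU]; exact x.2
    obtain ⟨u, hu, hux⟩ := h
    have : f.toEquiv.symm ⟨x.1, x.2.1⟩ = u := by
      rw [Equiv.symm_apply_eq]; exact Subtype.ext hux.symm
    rw [this]; exact hu⟩

theorem SpringerMorphism.restrict_preimage (f : SpringerMorphism n F K) (x : uu n F K) :
    f.restrict (f.preimage x) = x := by
  apply Subtype.ext
  simp [SpringerMorphism.restrict, SpringerMorphism.preimage]

end Groups

section Supercharacters

variable {n : ℕ} {F K : Type*} [Field F] [Fintype F] [Field K] [Algebra F K]
  [Algebra.IsQuadraticExtension F K]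

/-- The orbit `G · lam` in the dual of `𝔲𝔲ₙ(K)`, where `G = UTₙ(K)`. -/
def orbitUT (lam : Module.Dual F (uu n F K)) : Set (Module.Dual F (uu n F K)) :=
  {μ | ∃ g : UT n K, (act n F K).dual g lam = μ}

/-- The orbit `H · lam` in the dual of `𝔲𝔲ₙ(K)`. -/
def orbitH (lam : Module.Dual F (uu n F K)) : Set (Module.Dual F (uu n F K)) :=
  {μ | ∃ h ∈ colSubgroup n K, (act n F K).dual h lam = μ}

/-- The supercharacter
`χ_lam(u) = (|H · lam| / |G · lam|) ∑ θ(μ(f(u)))`, where `μ` runs over `G · lam`. -/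
noncomputable def supercharacter (f : SpringerMorphism n F K) (θ : AddChar F ℂ)
    (lam : Module.Dual F (uu n F K)) (u : UU n F K) : ℂ :=
  ((orbitH lam).ncard / (orbitUT lam).ncard : ℂ) * ∑ᶠ μ ∈ orbitUT lam, θ (μ (f.restrict u))

end Supercharacters

/-- An arc from `src` to `tgt` carrying the label `label`. -/
@[ext] structure Arc (n : ℕ) (K : Type*) where
  src : Fin n
  tgt : Fin n
  label : K

/-- A labeled set partition of `{1, …, n}` (for the field `K`), given by its arcs: the pairs
`i < j` of consecutive elements of a block, each with a nonzero label in `K`. A set of arcs `i < j`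
comes from a set partition if and only if no two of them have the same left end or the same right
end. -/
structure LabeledSetPartition (n : ℕ) (K : Type*) [Field K] where
  arcs : Finset (Arc n K)
  src_lt_tgt : ∀ s ∈ arcs, s.src < s.tgt
  label_ne_zero : ∀ s ∈ arcs, s.label ≠ 0
  src_inj : ∀ s ∈ arcs, ∀ t ∈ arcs, s.src = t.src → s = t
  tgt_inj : ∀ s ∈ arcs, ∀ t ∈ arcs, s.tgt = t.tgt → s = t

/-- `i ⌢ j` is an arc, with some label. -/
def LabeledSetPartition.HasArc {n : ℕ} {K : Type*} [Field K] (η : LabeledSetPartition n K)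
    (i j : Fin n) : Prop :=
  ∃ a : K, (⟨i, j, a⟩ : Arc n K) ∈ η.arcs

section Twisted

variable (n : ℕ) (F K : Type*) [Field F] [Fintype F] [Field K] [Algebra F K]

/-- A twisted set partition: with every arc `i ⌢ j` with label `a` it has the
arc `j.rev ⌢ i.rev` with label `-a ^ q`. -/
structure TwistedSetPartition extends LabeledSetPartition n K where
  twisted : ∀ s ∈ arcs, (⟨s.tgt.rev, s.src.rev, -s.label ^ Fintype.card F⟩ : Arc n K) ∈ arcs

variable {n F K}

/-- The number of quadruples `i < j < k < l` with `j ⌢ k` in `ν` and `i ⌢ l` in `η`. -/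
def nst (η ν : TwistedSetPartition n F K) : ℕ :=
  ((η.arcs ×ˢ ν.arcs).filter fun p => p.1.src < p.2.src ∧ p.2.tgt < p.1.tgt).card

/-- The sum of the products `a b` over all `i < j` such that `i ⌢ j` has label `a` in `η` and
label `b` in `ν`, as an element of `K`. -/
def commonArcSum (η ν : TwistedSetPartition n F K) : K :=
  ∑ p ∈ (η.arcs ×ˢ ν.arcs).filter fun p => p.1.src = p.2.src ∧ p.1.tgt = p.2.tgt,
    p.1.label * p.2.label

/-- The mirror image of an arc. -/
def mirror (F : Type*) [Fintype F] (s : Arc n K) : Arc n K :=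
  ⟨s.tgt.rev, s.src.rev, -s.label ^ Fintype.card F⟩

theorem neg_pow_card (a : K) : (-a) ^ Fintype.card F = -a ^ Fintype.card F :=
  map_neg (FiniteField.frobeniusAlgHom F K) a

theorem mirror_mirror [Algebra.IsQuadraticExtension F K] (s : Arc n K) :
    mirror F (mirror F s) = s := by
  ext <;> simp [mirror, neg_pow_card, pow_card_pow_card]

/-- The matrix whose entry at `(i, j)` is `a` if `i ⌢ j` is an arc of `η` with label `a` (there is
at most one such `a`), and `0` otherwise. -/
def arcMatrix (η : TwistedSetPartition n F K) : Matrix (Fin n) (Fin n) K :=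
  Matrix.of fun i j => ∑ s ∈ η.arcs.filter fun s => s.src = i ∧ s.tgt = j, s.label

theorem arcMatrix_of_mem (η : TwistedSetPartition n F K) {i j : Fin n} {a : K}
    (h : (⟨i, j, a⟩ : Arc n K) ∈ η.arcs) : arcMatrix η i j = a := by
  have : (η.arcs.filter fun s => s.src = i ∧ s.tgt = j) = {⟨i, j, a⟩} := by
    ext s
    simp only [Finset.mem_filter, Finset.mem_singleton]
    constructor
    · rintro ⟨hs, h1, -⟩
      exact η.src_inj s hs _ h h1
    · rintro rfl
      exact ⟨h, rfl, rfl⟩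
  simp [arcMatrix, this]

theorem arcMatrix_of_not_hasArc (η : TwistedSetPartition n F K) {i j : Fin n}
    (h : ¬ η.HasArc i j) : arcMatrix η i j = 0 := by
  have : (η.arcs.filter fun s => s.src = i ∧ s.tgt = j) = ∅ := by
    refine Finset.filter_eq_empty_iff.2 ?_
    rintro s hs ⟨rfl, rfl⟩
    exact h ⟨s.label, hs⟩
  simp [arcMatrix, this]

variable [Algebra.IsQuadraticExtension F K]

theorem arcMatrix_mem_uu (η : TwistedSetPartition n F K) : arcMatrix η ∈ uu n F K := by
  refine ⟨fun i j hij => arcMatrix_of_not_hasArc η ?_, ?_⟩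
  · rintro ⟨a, ha⟩
    exact absurd (η.src_lt_tgt _ ha) (not_lt.2 hij)
  · ext i j
    rw [dagger_apply, Matrix.neg_apply]
    by_cases h : η.HasArc i j
    · obtain ⟨a, ha⟩ := h
      rw [arcMatrix_of_mem η ha, arcMatrix_of_mem η (η.twisted _ ha), neg_pow_card,
        pow_card_pow_card]
    · have h' : ¬ η.HasArc j.rev i.rev := by
        rintro ⟨a, ha⟩
        have := η.twisted _ ha
        simp only [Fin.rev_rev] at this
        exact h ⟨_, this⟩
      rw [arcMatrix_of_not_hasArc η h, arcMatrix_of_not_hasArc η h',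
        zero_pow Fintype.card_ne_zero, neg_zero]

/-- The element `x_η` of `𝔲𝔲ₙ(K)`. -/
def xElt (η : TwistedSetPartition n F K) : uu n F K := ⟨arcMatrix η, arcMatrix_mem_uu η⟩

/-- The element `u_η` of `UUₙ(K)` with `f(u_η) = x_η`. -/
def uElt (f : SpringerMorphism n F K) (η : TwistedSetPartition n F K) : UU n F K :=
  f.preimage (xElt η)

theorem exists_algebraMap_arcSum (η : TwistedSetPartition n F K) (x : uu n F K) :
    ∃ c : F, algebraMap F K c = ∑ s ∈ η.arcs, s.label * x.1 s.src s.tgt := by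
  apply exists_algebraMap_of_pow_card
  have h := map_sum (FiniteField.frobeniusAlgHom F K)
    (fun s : Arc n K => s.label * x.1 s.src s.tgt) η.arcs
  simp only [FiniteField.coe_frobeniusAlgHom, mul_pow] at h
  rw [h]
  refine Finset.sum_nbij' (mirror F) (mirror F) η.twisted η.twisted
    (fun s _ => mirror_mirror s) (fun s _ => mirror_mirror s) fun s _ => ?_
  have h1 := congrFun (congrFun x.2.2 s.tgt.rev) s.src.rev
  rw [dagger_apply, Matrix.neg_apply, Fin.rev_rev, Fin.rev_rev] at h1
  simp [mirror, h1]

/-- The functional `x ↦ ∑ a xᵢⱼ` on `𝔲𝔲ₙ(K)`, where the sum runs over the arcs `i ⌢ j` of `η`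
and `a` is the label; its values lie in `F`. -/
noncomputable def lamElt (η : TwistedSetPartition n F K) : Module.Dual F (uu n F K) where
  toFun x := (exists_algebraMap_arcSum η x).choose
  map_add' x y := by
    apply (algebraMap F K).injective
    rw [map_add, (exists_algebraMap_arcSum η (x + y)).choose_spec,
      (exists_algebraMap_arcSum η x).choose_spec, (exists_algebraMap_arcSum η y).choose_spec]
    simp [mul_add, Finset.sum_add_distrib]
  map_smul' c x := by
    apply (algebraMap F K).injective
    rw [RingHom.id_apply, smul_eq_mul, map_mul, (exists_algebraMap_arcSum η (c • x)).choose_spec,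
      (exists_algebraMap_arcSum η x).choose_spec, Finset.mul_sum]
    refine Finset.sum_congr rfl fun s _ => ?_
    simp [Algebra.smul_def, mul_left_comm]

theorem algebraMap_lamElt (η : TwistedSetPartition n F K) (x : uu n F K) :
    algebraMap F K (lamElt η x) = ∑ s ∈ η.arcs, s.label * x.1 s.src s.tgt :=
  (exists_algebraMap_arcSum η x).choose_spec

/-- The supercharacter `χ^η`. -/
noncomputable def chi (f : SpringerMorphism n F K) (θ : AddChar F ℂ)
    (η : TwistedSetPartition n F K) : UU n F K → ℂ :=
  supercharacter f θ (lamElt η)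

end Twisted

end UnipotentUnitary

open scoped BigOperators

namespace UnipotentUnitary

set_option linter.unusedSectionVars false

/-! ### Averages over independent uniform coordinates. -/

section Expect

variable {ι κ : Type*} [Fintype ι] [DecidableEq ι] [Fintype κ]

/-! The sum over the orbit `G · λ` is an average over `G`, so that `χ^η(u_ν) = χ^η(1) · 𝔼_g θ(λ_η(g
x_ν g†))` (`supercharacter_eq`); the group `H` enters only through `χ^η(1)`. Expanding the matrix
product, an arc `i ⌢ j` of `η` with label `a` and an arc `k ⌢ l` of `ν` with label `b` contribute `a
b y z^q`, where `y` is the entry of `g` at the left ends `(i, k)` and `z` its entry at the left ends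
of the mirror image of the pair.

A pair and its mirror image contribute conjugate terms. Together they give the trace of `a b y z^q`
if they differ; a self-mirror pair gives `a b` times the norm of `y`, with `a b` in `F`
(`lamElt_act`). The left ends determine a pair, so different mirror orbits use different entries of
`g`. The entries above the diagonal are independent and uniform, and the average is a product over
mirror orbits (`expect_lamElt_act_eq_prod`).

Each factor is an elementary character sum. A nested self-mirror pair gives `-1/q` (`expect_norm`),
and two nested mirror pairs give `1/q² = (-q)⁻²`, so each nested pair accounts for one factor
`(-q)⁻¹`. If the arc of `ν` is a proper part of the arc of `η` with a common end, one of `y`, `z` is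
`1` and the other is free, so the factor vanishes. In all other cases the form is constant and
equals its value at `g = 1`; these values multiply to `θ(λ_η(x_ν))`. -/

theorem expect_update (e : ι) (Φ : (ι → κ) → ℂ) :
    𝔼 w : ι → κ, 𝔼 x : κ, Φ (Function.update w e x) = 𝔼 w : ι → κ, Φ w := by
  rcases isEmpty_or_nonempty κ with hκ | hκ
  · have : IsEmpty (ι → κ) := ⟨fun w => hκ.elim (w e)⟩
    simp [Finset.univ_eq_empty]
  -- Exchanging the coordinate `e` of `w` with the independent variable `x` is a bijection of the
  -- product.
  have hinv : Function.Involutive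
      (fun p : (ι → κ) × κ => (Function.update p.1 e p.2, p.1 e)) := fun p => by simp
  have h := Fintype.expect_bijective _ hinv.bijective
    (fun p : (ι → κ) × κ => Φ (Function.update p.1 e p.2)) (fun p => Φ p.1) fun p => rfl
  rw [← Finset.univ_product_univ, Finset.expect_product, Finset.expect_product] at h
  simpa [Fintype.expect_const] using h

theorem expect_apply (e : ι) (φ : κ → ℂ) : 𝔼 w : ι → κ, φ (w e) = 𝔼 x : κ, φ x := by
  rcases isEmpty_or_nonempty κ with hκ | hκ
  · have : IsEmpty (ι → κ) := ⟨fun w => hκ.elim (w e)⟩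
    simp [Finset.univ_eq_empty]
  rw [← expect_update e]
  simp

theorem expect_mul_of_dependsOn {S T : Set ι} (hST : Disjoint S T) {Φ Ψ : (ι → κ) → ℂ}
    (hΦ : DependsOn Φ S) (hΨ : DependsOn Ψ T) :
    𝔼 w : ι → κ, Φ w * Ψ w = (𝔼 w : ι → κ, Φ w) * 𝔼 w : ι → κ, Ψ w := by
  classical
  rcases isEmpty_or_nonempty (ι → κ) with hκ | hκ
  · simp [Finset.univ_eq_empty]
  -- Two independent copies of the coordinates swap their `T`-parts; afterwards both functions can
  -- be read from the first copy.
  have hinv : Function.Involutive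
      (fun p : (ι → κ) × (ι → κ) => (T.piecewise p.2 p.1, T.piecewise p.1 p.2)) := fun p => by
    ext i <;> by_cases hi : i ∈ T <;> simp [Set.piecewise, hi]
  have h := Fintype.expect_bijective _ hinv.bijective
    (fun p : (ι → κ) × (ι → κ) => Φ p.1 * Ψ p.2) (fun p => Φ p.1 * Ψ p.1) fun p => by
      have h1 : Φ p.1 = Φ (T.piecewise p.2 p.1) := hΦ fun i hi => by
        rw [Set.piecewise_eq_of_notMem _ _ _ (hST.notMem_of_mem_left hi)]
      have h2 : Ψ p.2 = Ψ (T.piecewise p.2 p.1) := hΨ fun i hi => by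
        rw [Set.piecewise_eq_of_mem _ _ _ hi]
      rw [h1, h2]
  rw [← Finset.univ_product_univ, Finset.expect_product, Finset.expect_product] at h
  rw [Fintype.expect_mul_expect, h]
  simp

theorem expect_prod_of_dependsOn {α : Type*} (R : Finset α) (S : α → Set ι)
    (hS : (R : Set α).PairwiseDisjoint S) (Φ : α → (ι → κ) → ℂ)
    (hΦ : ∀ p ∈ R, DependsOn (Φ p) (S p)) [Nonempty κ] :
    𝔼 w : ι → κ, ∏ p ∈ R, Φ p w = ∏ p ∈ R, 𝔼 w : ι → κ, Φ p w := by
  classical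
  induction R using Finset.induction_on with
  | empty => simp
  | insert a R ha ih =>
    have hd : Disjoint (S a) (⋃ p ∈ R, S p) := by
      simp only [Set.disjoint_iUnion_right]
      intro p hp
      exact hS (by simp) (by simp [hp]) (by rintro rfl; exact ha hp)
    have hdep : DependsOn (fun w => ∏ p ∈ R, Φ p w) (⋃ p ∈ R, S p) := fun x y hxy =>
      Finset.prod_congr rfl fun p hp => hΦ p (Finset.mem_insert_of_mem hp) fun i hi =>
        hxy i (Set.mem_biUnion (by exact hp) hi)
    simp only [Finset.prod_insert ha]
    rw [expect_mul_of_dependsOn hd (hΦ a (Finset.mem_insert_self a R)) hdep, ih]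
    · exact hS.subset (by simp)
    · exact fun p hp => hΦ p (Finset.mem_insert_of_mem hp)

end Expect

/-- Each orbit of the involution `m` is represented by its member with the smaller key; a fixed
point must be counted only once. -/
theorem sum_eq_sum_filter_key_le {α β M : Type*} [LinearOrder β] [AddCommMonoid M]
    [DecidableEq α] (P : Finset α) (m : α → α) (key : α → β) (hm : ∀ p ∈ P, m p ∈ P)
    (hmm : ∀ p ∈ P, m (m p) = p) (hkey : Set.InjOn key P) (h : α → M) :
    ∑ p ∈ P, h p = ∑ p ∈ P with key p ≤ key (m p), (h p + if m p = p then 0 else h (m p)) := by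
  rw [← Finset.sum_filter_add_sum_filter_not P (fun p => key p ≤ key (m p)),
    Finset.sum_add_distrib]
  congr 1
  have hf : ∀ p, (if m p = p then 0 else h (m p)) = if m p ≠ p then h (m p) else 0 := fun p => by
    split_ifs <;> simp_all
  simp only [hf]
  rw [← Finset.sum_filter, Finset.filter_filter]
  refine Finset.sum_nbij' m m ?_ ?_ ?_ ?_ ?_
  · intro p hp
    simp only [Finset.mem_filter, not_le] at hp ⊢
    refine ⟨hm p hp.1, ?_, ?_⟩
    · rw [hmm p hp.1]; exact hp.2.le
    · intro h1
      rw [hmm p hp.1] at h1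
      rw [← h1] at hp
      exact lt_irrefl _ (h1 ▸ hp.2)
  · intro p hp
    simp only [Finset.mem_filter, not_le] at hp ⊢
    refine ⟨hm p hp.1, ?_⟩
    rw [hmm p hp.1]
    -- Injectivity of the key makes the inequality strict off the fixed points.
    exact lt_of_le_of_ne hp.2.1 fun h1 => hp.2.2 (hkey hp.1 (hm p hp.1) h1).symm
  · intro p hp; exact hmm p (Finset.mem_filter.1 hp).1
  · intro p hp; exact hmm p (Finset.mem_filter.1 hp).1
  · intro p hp; rw [hmm p (Finset.mem_filter.1 hp).1]

theorem map_sum_eq_prod {A α : Type*} [AddCommMonoid A] (θ : AddChar A ℂ) (R : Finset α)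
    (φ : α → A) : θ (∑ p ∈ R, φ p) = ∏ p ∈ R, θ (φ p) := by
  classical
  induction R using Finset.induction_on with
  | empty => simp
  | insert a R ha ih => rw [Finset.sum_insert ha, Finset.prod_insert ha, AddChar.map_add_eq_mul, ih]

/-! ### Character sums for the trace and the norm of `K / F`. -/

section CharacterSums

variable {F K : Type*} [Field F] [Fintype F] [Field K] [Algebra F K]
  [Algebra.IsQuadraticExtension F K] [Fintype K]

variable (F K) in
theorem card_eq_card_sq : Fintype.card K = Fintype.card F ^ 2 := by
  rw [Module.card_eq_pow_finrank (K := F) (V := K),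
      Algebra.IsQuadraticExtension.finrank_eq_two F K]

theorem algebraMap_trace_eq (x : K) :
    algebraMap F K (Algebra.trace F K x) = x + x ^ Fintype.card F := by
  rw [FiniteField.algebraMap_trace_eq_sum_pow, Algebra.IsQuadraticExtension.finrank_eq_two F K]
  simp [Finset.sum_range_succ]

theorem algebraMap_norm_eq (x : K) :
    algebraMap F K (Algebra.norm F x) = x * x ^ Fintype.card F := by
  rw [FiniteField.algebraMap_norm_eq_pow_sum, Algebra.IsQuadraticExtension.finrank_eq_two F K]
  simp [Finset.sum_range_succ, pow_add]

variable {θ : AddChar F ℂ}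

theorem expect_trace [DecidableEq K] (hθ : θ ≠ 1) (c : K) :
    𝔼 x : K, θ (Algebra.trace F K (c * x)) = if c = 0 then 1 else 0 := by
  set ψ : AddChar K ℂ := θ.compAddMonoidHom (Algebra.trace F K).toAddMonoidHom with hψ
  have h1 : ψ ≠ 1 := by
    intro h
    apply hθ
    ext y
    obtain ⟨x, rfl⟩ := Algebra.trace_surjective F K y
    exact DFunLike.congr_fun h x
  have h2 := AddChar.sum_mulShift c (AddChar.IsPrimitive.of_ne_one h1)
  have h3 : ∀ x, θ (Algebra.trace F K (c * x)) = ψ (x * c) := fun x => by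
    rw [mul_comm]; rfl
  simp only [h3, Fintype.expect_eq_sum_div_card, h2]
  split_ifs <;> simp

theorem expect_trace_pow [DecidableEq K] (hθ : θ ≠ 1) (c : K) :
    𝔼 x : K, θ (Algebra.trace F K (c * x ^ Fintype.card F)) = if c = 0 then 1 else 0 := by
  rw [← expect_trace (F := F) hθ]
  have hinv : Function.Involutive (fun x : K => x ^ Fintype.card F) := pow_card_pow_card
  exact Fintype.expect_bijective _ hinv.bijective _ _ fun x => rfl

theorem sum_eq_zero_add_sum_units {E : Type*} [Field E] [Fintype E] [DecidableEq E] (g : E → ℂ) :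
    ∑ x : E, g x = g 0 + ∑ x : Eˣ, g x := by
  rw [← Finset.add_sum_erase _ _ (Finset.mem_univ (0 : E))]
  congr 1
  symm
  exact Finset.sum_bij' (fun x _ => (x : E)) (fun x hx => Units.mk0 x (Finset.ne_of_mem_erase hx))
    (by simp) (by simp) (by simp) (by simp) (by simp)

/-- The norm maps `Kˣ` onto `Fˣ` with fibers of size `q + 1`, and a nontrivial character sums to
`-1` over `Fˣ`. So the sum over `K` is `1 - (q + 1) = -q`, to be divided by `q²`. -/
theorem expect_norm (hθ : θ ≠ 1) {d : F} (hd : d ≠ 0) :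
    𝔼 x : K, θ (d * Algebra.norm F x) = (-(Fintype.card F : ℂ))⁻¹ := by
  classical
  have hq : (Fintype.card F : ℂ) ≠ 0 := by simp
  have hsum : ∑ y : F, θ (y * d) = 0 := by
    rw [AddChar.sum_mulShift d (AddChar.IsPrimitive.of_ne_one hθ), if_neg hd, Nat.cast_zero]
  rw [sum_eq_zero_add_sum_units, zero_mul, AddChar.map_zero_eq_one] at hsum
  have hsurj := FiniteField.unitsMap_norm_surjective F K
  obtain ⟨m, hm⟩ : ∃ m : ℕ, ∀ g : Fˣ → ℂ,
      ∑ x : Kˣ, g (Units.map (Algebra.norm F) x) = m * ∑ y, g y := by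
    refine ⟨(Finset.univ.filter fun x : Kˣ => Units.map (Algebra.norm F) x = 1).card, fun g => ?_⟩
    rw [Finset.sum_comp g, Finset.image_univ_of_surjective hsurj, Finset.mul_sum]
    refine Finset.sum_congr rfl fun y _ => ?_
    rw [nsmul_eq_mul, MonoidHom.card_fiber_eq_of_mem_range (Units.map (Algebra.norm F)) (hsurj y)
      (hsurj 1)]
  have hm1 : (m : ℂ) = Fintype.card F + 1 := by
    -- Counting units gives `q² - 1 = m (q - 1)`.
    have h1 := hm fun _ => 1
    have hK : (Fintype.card Kˣ : ℂ) = (Fintype.card F : ℂ) ^ 2 - 1 := by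
      rw [Fintype.card_units, card_eq_card_sq F K, Nat.cast_sub (Nat.one_le_pow _ _ Fintype.card_pos)]
      simp
    have hF : (Fintype.card Fˣ : ℂ) = (Fintype.card F : ℂ) - 1 := by
      rw [Fintype.card_units, Nat.cast_sub Fintype.card_pos]
      simp
    have hne : (Fintype.card F : ℂ) - 1 ≠ 0 := by
      rw [← hF]; simp
    simp only [Finset.sum_const, Finset.card_univ, nsmul_eq_mul, mul_one, hK, hF] at h1
    apply mul_right_cancel₀ hne
    rw [← h1]; ring
  have hm2 := hm fun y => θ (y * d)
  rw [Fintype.expect_eq_sum_div_card, sum_eq_zero_add_sum_units, card_eq_card_sq F K]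
  simp only [Units.coe_map] at hm2
  simp only [Algebra.norm_zero, zero_mul, AddChar.map_zero_eq_one, mul_comm d, hm2, hm1,
    eq_neg_of_add_eq_zero_right hsum]
  push_cast
  field_simp
  ring

end CharacterSums

/-! ### The form `λ_η(g x_ν g†)` as a sum over mirror orbits of pairs of arcs. -/

section ArcPairs

variable {n : ℕ} {F K : Type*} [Field F] [Fintype F] [Field K] [Algebra F K]
  [Algebra.IsQuadraticExtension F K] [Fintype K]

variable (F) in
/-- The mirror image of a pair of arcs. -/
def mirrorPair (p : Arc n K × Arc n K) : Arc n K × Arc n K := (mirror F p.1, mirror F p.2)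

/-- The left ends of a pair of arcs, ordered lexicographically. -/
def srcPair (p : Arc n K × Arc n K) : Lex (Fin n × Fin n) := toLex (p.1.src, p.2.src)

/-- The arc `p.2` is nested in the arc `p.1`. -/
def Nested (p : Arc n K × Arc n K) : Prop := p.1.src < p.2.src ∧ p.2.tgt < p.1.tgt

/-- The arc `p.2` is a proper part of the arc `p.1` and shares an end with it. -/
def SharesEnd (p : Arc n K × Arc n K) : Prop :=
  p.1.src = p.2.src ∧ p.2.tgt < p.1.tgt ∨ p.1.src < p.2.src ∧ p.2.tgt = p.1.tgt

open Classical in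
/-- The contribution of a pair of arcs and its mirror image to `lamElt η (g x_ν g†)`, where
`y` and `z` are the entries of `g` at the left ends of the pair and of its mirror image. -/
noncomputable def pairForm (p : Arc n K × Arc n K) (y z : K) : F :=
  if mirrorPair F p = p then
    Function.invFun (algebraMap F K) (p.1.label * p.2.label) * Algebra.norm F y
  else Algebra.trace F K (p.1.label * p.2.label * y * z ^ Fintype.card F)

theorem mirrorPair_mirrorPair (p : Arc n K × Arc n K) : mirrorPair F (mirrorPair F p) = p := by
  simp [mirrorPair, mirror_mirror]

theorem mirrorPair_mem {η ν : TwistedSetPartition n F K} {p : Arc n K × Arc n K}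
    (hp : p ∈ η.arcs ×ˢ ν.arcs) : mirrorPair F p ∈ η.arcs ×ˢ ν.arcs := by
  rw [Finset.mem_product] at hp ⊢
  exact ⟨η.twisted _ hp.1, ν.twisted _ hp.2⟩

theorem injOn_srcPair (η ν : TwistedSetPartition n F K) :
    Set.InjOn srcPair (↑(η.arcs ×ˢ ν.arcs) : Set (Arc n K × Arc n K)) := by
  rintro ⟨s, t⟩ hp ⟨s', t'⟩ hp' h
  simp only [Finset.coe_product, Set.mem_prod, Finset.mem_coe] at hp hp'
  obtain ⟨h1, h2⟩ := Prod.ext_iff.1 (toLex.injective h)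
  exact Prod.ext (η.src_inj _ hp.1 _ hp'.1 h1) (ν.src_inj _ hp.2 _ hp'.2 h2)

/-- Both labels of a self-mirror pair satisfy `a ^ q = -a`, so their product is fixed by Frobenius
and lies in `F`. -/
theorem algebraMap_invFun_label {p : Arc n K × Arc n K} (h : mirrorPair F p = p) :
    algebraMap F K (Function.invFun (algebraMap F K) (p.1.label * p.2.label)) =
      p.1.label * p.2.label := by
  apply Function.invFun_eq
  apply exists_algebraMap_of_pow_card
  have h1 : -p.1.label ^ Fintype.card F = p.1.label := congrArg (fun p => p.1.label) h
  have h2 : -p.2.label ^ Fintype.card F = p.2.label := congrArg (fun p => p.2.label) h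
  rw [mul_pow]
  conv_rhs => rw [← h1, ← h2]
  ring

theorem pairForm_of_eq_zero {p : Arc n K × Arc n K} {y z : K} (hyz : mirrorPair F p = p → y = z)
    (h : y = 0 ∨ z = 0) : pairForm p y z = (0 : F) := by
  unfold pairForm
  split_ifs with hm
  · have := hyz hm
    subst this
    rw [or_self] at h
    simp [h, Algebra.norm_zero]
  · rcases h with h | h <;> simp [h, Fintype.card_ne_zero]

/-- Mirroring exchanges the two entries and sends `a b` to `(-a^q)(-b^q) = (a b)^q`, so the term of
the mirror image is the conjugate of the term of the pair. -/
theorem sum_pairs_eq_algebraMap (η ν : TwistedSetPartition n F K) (y : Fin n → Fin n → K) :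
    ∑ p ∈ η.arcs ×ˢ ν.arcs, p.1.label * p.2.label * y p.1.src p.2.src *
        y p.1.tgt.rev p.2.tgt.rev ^ Fintype.card F =
      algebraMap F K (∑ p ∈ η.arcs ×ˢ ν.arcs with srcPair p ≤ srcPair (mirrorPair F p),
        pairForm p (y p.1.src p.2.src) (y p.1.tgt.rev p.2.tgt.rev)) := by
  classical
  rw [sum_eq_sum_filter_key_le (η.arcs ×ˢ ν.arcs) (mirrorPair F) srcPair
    (fun p hp => mirrorPair_mem hp) (fun p _ => mirrorPair_mirrorPair p) (injOn_srcPair η ν),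
    map_sum]
  refine Finset.sum_congr rfl fun p _ => ?_
  unfold pairForm
  split_ifs with hm
  · have h1 : p.1.tgt.rev = p.1.src := congrArg (fun p => p.1.src) hm
    have h2 : p.2.tgt.rev = p.2.src := congrArg (fun p => p.2.src) hm
    rw [map_mul, algebraMap_invFun_label hm, algebraMap_norm_eq, h1, h2]
    ring
  · rw [algebraMap_trace_eq]
    simp only [mirrorPair, mirror, Fin.rev_rev, mul_pow, pow_card_pow_card]
    ring

theorem mul_arcMatrix_mul_apply (ν : TwistedSetPartition n F K) (A B : Matrix (Fin n) (Fin n) K)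
    (i j : Fin n) :
    (A * arcMatrix ν * B) i j = ∑ t ∈ ν.arcs, A i t.src * t.label * B t.tgt j := by
  have h : arcMatrix ν = ∑ t ∈ ν.arcs, Matrix.single t.src t.tgt t.label := by
    ext k l
    simp [arcMatrix, Matrix.sum_apply, Matrix.single_apply, Finset.sum_filter]
  rw [h, Matrix.mul_sum, Matrix.sum_mul, Matrix.sum_apply]
  refine Finset.sum_congr rfl fun t _ => ?_
  rw [Matrix.mul_apply, Finset.sum_eq_single t.tgt]
  · simp
  · intro l _ hl
    rw [Matrix.mul_single_apply_of_ne _ _ _ _ _ hl, zero_mul]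
  · simp

theorem lamElt_act (η ν : TwistedSetPartition n F K) (g : UT n K) :
    lamElt η (act n F K g (xElt ν)) =
      ∑ p ∈ η.arcs ×ˢ ν.arcs with srcPair p ≤ srcPair (mirrorPair F p),
        pairForm p (g.1.1 p.1.src p.2.src) (g.1.1 p.1.tgt.rev p.2.tgt.rev) := by
  apply (algebraMap F K).injective
  rw [← sum_pairs_eq_algebraMap η ν g.1.1, algebraMap_lamElt, Finset.sum_product]
  refine Finset.sum_congr rfl fun s _ => ?_
  have h : (act n F K g (xElt ν)).1 = g.1.1 * arcMatrix ν * dagger F g.1.1 := rfl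
  rw [h, mul_arcMatrix_mul_apply, Finset.mul_sum]
  refine Finset.sum_congr rfl fun t _ => ?_
  rw [dagger_apply]
  ring

theorem algebraMap_lamElt_xElt (η ν : TwistedSetPartition n F K) :
    algebraMap F K (lamElt η (xElt ν)) = commonArcSum η ν := by
  rw [algebraMap_lamElt, commonArcSum, Finset.sum_filter, Finset.sum_product]
  refine Finset.sum_congr rfl fun s _ => ?_
  simp only [xElt, arcMatrix, Matrix.of_apply, Finset.sum_filter, Finset.mul_sum]
  refine Finset.sum_congr rfl fun t _ => ?_
  simp only [eq_comm, mul_ite, mul_zero]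

end ArcPairs

/-! ### The entries above the diagonal as coordinates on `UTₙ(K)`. -/

section Entries

variable {n : ℕ} {K : Type*} [Field K]

variable (n) in
/-- The positions above the diagonal. -/
abbrev AboveDiag : Type := {p : Fin n × Fin n // p.1 < p.2}

/-- The unipotent upper triangular matrix with given entries above the diagonal. -/
def unipotentMatrix (w : AboveDiag n → K) : Matrix (Fin n) (Fin n) K :=
  Matrix.of fun i j => if h : i < j then w ⟨(i, j), h⟩ else if i = j then 1 else 0

theorem unipotentMatrix_of_lt (w : AboveDiag n → K) {i j : Fin n} (h : i < j) :
    unipotentMatrix w i j = w ⟨(i, j), h⟩ := by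
  simp [unipotentMatrix, h]

theorem unipotentMatrix_of_gt (w : AboveDiag n → K) {i j : Fin n} (h : j < i) :
    unipotentMatrix w i j = 0 := by
  simp [unipotentMatrix, h.not_gt, h.ne']

theorem unipotentMatrix_self (w : AboveDiag n → K) (i : Fin n) : unipotentMatrix w i i = 1 := by
  simp [unipotentMatrix]

theorem det_unipotentMatrix (w : AboveDiag n → K) : (unipotentMatrix w).det = 1 := by
  rw [Matrix.det_of_isUpperTriangular]
  · simp [unipotentMatrix_self]
  · intro i j h
    exact unipotentMatrix_of_gt w h

/-- An element of `UTₙ(K)` is determined by its entries above the diagonal, which are arbitrary. -/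
noncomputable def equivUT : (AboveDiag n → K) ≃ UT n K where
  toFun w := ⟨Matrix.GeneralLinearGroup.mkOfDetNeZero (unipotentMatrix w)
      (by rw [det_unipotentMatrix]; exact one_ne_zero),
    fun _ _ h => unipotentMatrix_of_gt w h, fun i => unipotentMatrix_self w i⟩
  invFun g e := g.1.1 e.1.1 e.1.2
  left_inv w := by
    ext e
    exact unipotentMatrix_of_lt w e.2
  right_inv g := by
    apply Subtype.ext
    apply Units.ext
    ext i j
    change unipotentMatrix (fun e : AboveDiag n => g.1.1 e.1.1 e.1.2) i j = g.1.1 i j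
    rcases lt_trichotomy i j with h | rfl | h
    · rw [unipotentMatrix_of_lt _ h]
    · rw [unipotentMatrix_self, g.2.2]
    · rw [unipotentMatrix_of_gt _ h, g.2.1 i j h]

theorem coe_equivUT (w : AboveDiag n → K) : (equivUT w : UT n K).1.1 = unipotentMatrix w := rfl

/-- On and below the diagonal the set of coordinates is empty: the entry is constant. -/
theorem dependsOn_unipotentMatrix (i j : Fin n) :
    DependsOn (fun w : AboveDiag n → K => unipotentMatrix w i j) {e | e.1 = (i, j)} := by
  intro w w' h
  by_cases hij : i < j
  · simpa only [unipotentMatrix_of_lt _ hij] using h ⟨(i, j), hij⟩ rfl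
  · simp [unipotentMatrix, hij]

end Entries

/-! ### The average of each factor, and their product. -/

section Averages

variable {n : ℕ} {F K : Type*} [Field F] [Fintype F] [Field K] [Algebra F K]
  [Algebra.IsQuadraticExtension F K] [Fintype K] {η ν : TwistedSetPartition n F K}

open Classical in
/-- The number of nested pairs among a pair of arcs and its mirror image. -/
noncomputable def nestedCount (F : Type*) [Fintype F] (p : Arc n K × Arc n K) : ℕ :=
  (if Nested p then 1 else 0) +
    if mirrorPair F p = p then 0 else if Nested (mirrorPair F p) then 1 else 0

theorem nested_mirrorPair (p : Arc n K × Arc n K) : Nested (mirrorPair F p) ↔ Nested p := by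
  simp [Nested, mirrorPair, mirror, and_comm]

theorem sharesEnd_mirrorPair (p : Arc n K × Arc n K) :
    SharesEnd (mirrorPair F p) ↔ SharesEnd p := by
  simp only [SharesEnd, mirrorPair, mirror, Fin.rev_lt_rev, Fin.rev_inj]
  constructor <;> rintro (⟨h1, h2⟩ | ⟨h1, h2⟩) <;> simp_all

theorem mirrorPair_eq_of_ends {p : Arc n K × Arc n K} (hp : p ∈ η.arcs ×ˢ ν.arcs)
    (h1 : p.1.src = p.1.tgt.rev) (h2 : p.2.src = p.2.tgt.rev) : mirrorPair F p = p := by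
  refine injOn_srcPair η ν (mirrorPair_mem hp) hp ?_
  simp [srcPair, mirrorPair, mirror, ← h1, ← h2]

theorem labels_ne_zero {p : Arc n K × Arc n K} (hp : p ∈ η.arcs ×ˢ ν.arcs) :
    p.1.label * p.2.label ≠ 0 := by
  rw [Finset.mem_product] at hp
  exact mul_ne_zero (η.label_ne_zero _ hp.1) (ν.label_ne_zero _ hp.2)

theorem apply_src_eq_of_mirrorPair_eq {p : Arc n K × Arc n K} (h : mirrorPair F p = p)
    (A : Matrix (Fin n) (Fin n) K) : A p.1.src p.2.src = A p.1.tgt.rev p.2.tgt.rev := by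
  have h1 : p.1.tgt.rev = p.1.src := congrArg (fun p => p.1.src) h
  have h2 : p.2.tgt.rev = p.2.src := congrArg (fun p => p.2.src) h
  rw [h1, h2]

variable {θ : AddChar F ℂ}

theorem expect_pairForm_of_sharesEnd (hθ : θ ≠ 1) {p : Arc n K × Arc n K}
    (hp : p ∈ η.arcs ×ˢ ν.arcs) (h : SharesEnd p) :
    𝔼 w : AboveDiag n → K, θ (pairForm p (unipotentMatrix w p.1.src p.2.src)
      (unipotentMatrix w p.1.tgt.rev p.2.tgt.rev)) = 0 := by
  classical
  have hc := labels_ne_zero hp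
  -- In a self-mirror pair, a common left end forces a common right end and conversely.
  have hm : mirrorPair F p ≠ p := by
    intro hm
    have h1 : p.1.tgt.rev = p.1.src := congrArg (fun p => p.1.src) hm
    have h2 : p.2.tgt.rev = p.2.src := congrArg (fun p => p.2.src) hm
    rw [SharesEnd, ← h1, ← h2, Fin.rev_lt_rev, Fin.rev_inj] at h
    rcases h with ⟨h3, h4⟩ | ⟨h3, h4⟩
    · exact h4.ne h3.symm
    · exact h3.ne h4
  simp only [pairForm, if_neg hm]
  rcases h with ⟨h1, h2⟩ | ⟨h1, h2⟩
  · simp only [h1, unipotentMatrix_self, unipotentMatrix_of_lt _ (Fin.rev_lt_rev.2 h2), mul_one]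
    rw [expect_apply _ fun x => θ (Algebra.trace F K (p.1.label * p.2.label * x ^ Fintype.card F)),
      expect_trace_pow hθ, if_neg hc]
  · simp only [h2, unipotentMatrix_self, unipotentMatrix_of_lt _ h1, mul_one, one_pow]
    rw [expect_apply _ fun x => θ (Algebra.trace F K (p.1.label * p.2.label * x)),
      expect_trace hθ, if_neg hc]

theorem expect_pairForm_of_nested (hθ : θ ≠ 1) {p : Arc n K × Arc n K}
    (hp : p ∈ η.arcs ×ˢ ν.arcs) (h : Nested p) :
    𝔼 w : AboveDiag n → K, θ (pairForm p (unipotentMatrix w p.1.src p.2.src)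
      (unipotentMatrix w p.1.tgt.rev p.2.tgt.rev)) =
        (-(Fintype.card F : ℂ))⁻¹ ^ nestedCount F p := by
  classical
  have hc := labels_ne_zero hp
  simp only [pairForm, nestedCount, nested_mirrorPair, if_pos h, unipotentMatrix_of_lt _ h.1,
    unipotentMatrix_of_lt _ (Fin.rev_lt_rev.2 h.2)]
  split_ifs with hm
  · have hd : Function.invFun (algebraMap F K) (p.1.label * p.2.label) ≠ 0 := by
      intro h0
      apply hc
      rw [← algebraMap_invFun_label hm, h0, map_zero]
    rw [expect_apply _ fun x => θ (_ * Algebra.norm F x), expect_norm hθ hd, pow_one]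
  · have hne : (⟨(p.1.src, p.2.src), h.1⟩ : AboveDiag n) ≠
        ⟨(p.1.tgt.rev, p.2.tgt.rev), Fin.rev_lt_rev.2 h.2⟩ := fun h0 => by
      rw [Subtype.mk.injEq, Prod.mk.injEq] at h0
      exact hm (mirrorPair_eq_of_ends hp h0.1 h0.2)
    -- Averaging over `y` first gives `1` if `z = 0` and `0` otherwise; then `z = 0` has probability
    -- `1 / q²`.
    rw [← expect_update ⟨(p.1.src, p.2.src), h.1⟩]
    simp only [Function.update_self, Function.update_of_ne hne.symm]
    generalize p.1.label * p.2.label = c at hc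
    have hcomm : ∀ (w : AboveDiag n → K) (e : AboveDiag n) (x : K),
        c * x * w e ^ Fintype.card F = c * w e ^ Fintype.card F * x := fun w e x =>
      mul_right_comm c _ _
    simp only [hcomm, expect_trace hθ, mul_eq_zero, hc, false_or,
      pow_eq_zero_iff Fintype.card_ne_zero]
    rw [expect_apply _ fun x : K => if x = 0 then (1 : ℂ) else 0, Fintype.expect_eq_sum_div_card]
    simp [card_eq_card_sq F K]

/-- The value at the identity matrix is kept as a factor so that the product over all orbits
reassembles `λ_η(x_ν)`. For a nested pair this value is trivial. -/
theorem expect_pairForm_of_not_sharesEnd (hθ : θ ≠ 1) {p : Arc n K × Arc n K}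
    (hp : p ∈ η.arcs ×ˢ ν.arcs) (h : ¬ SharesEnd p) :
    𝔼 w : AboveDiag n → K, θ (pairForm p (unipotentMatrix w p.1.src p.2.src)
      (unipotentMatrix w p.1.tgt.rev p.2.tgt.rev)) =
        (-(Fintype.card F : ℂ))⁻¹ ^ nestedCount F p *
          θ (pairForm p ((1 : Matrix (Fin n) (Fin n) K) p.1.src p.2.src)
            ((1 : Matrix (Fin n) (Fin n) K) p.1.tgt.rev p.2.tgt.rev)) := by
  classical
  by_cases hN : Nested p
  · rw [expect_pairForm_of_nested hθ hp hN, pairForm_of_eq_zero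
      (fun hm => apply_src_eq_of_mirrorPair_eq hm _) (Or.inl (Matrix.one_apply_ne hN.1.ne)),
      AddChar.map_zero_eq_one, mul_one]
  have h0 : nestedCount F p = 0 := by simp [nestedCount, nested_mirrorPair, hN]
  rw [h0, pow_zero, one_mul]
  have hconst : ∀ w : AboveDiag n → K,
      (pairForm p (unipotentMatrix w p.1.src p.2.src)
        (unipotentMatrix w p.1.tgt.rev p.2.tgt.rev) : F) =
      pairForm p ((1 : Matrix (Fin n) (Fin n) K) p.1.src p.2.src)
            ((1 : Matrix (Fin n) (Fin n) K) p.1.tgt.rev p.2.tgt.rev) := by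
    intro w
    -- Either an entry below the diagonal kills the form, or the two arcs have the same ends and
    -- both entries are `1`.
    by_cases hgt : p.2.src < p.1.src ∨ p.1.tgt < p.2.tgt
    · rw [pairForm_of_eq_zero (fun hm => apply_src_eq_of_mirrorPair_eq hm _),
        pairForm_of_eq_zero (fun hm => apply_src_eq_of_mirrorPair_eq hm _)]
      · exact hgt.imp (fun h => Matrix.one_apply_ne h.ne')
          fun h => Matrix.one_apply_ne (Fin.rev_lt_rev.2 h).ne'
      · exact hgt.imp (fun h => unipotentMatrix_of_gt _ h)
          fun h => unipotentMatrix_of_gt _ (Fin.rev_lt_rev.2 h)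
    · rw [not_or, not_lt, not_lt] at hgt
      obtain ⟨h1, h2⟩ := hgt
      have h3 : p.1.src = p.2.src ∧ p.2.tgt = p.1.tgt := by
        rcases h1.eq_or_lt with h1 | h1 <;> rcases h2.eq_or_lt with h2 | h2
        · exact ⟨h1, h2⟩
        · exact (h (Or.inl ⟨h1, h2⟩)).elim
        · exact (h (Or.inr ⟨h1, h2⟩)).elim
        · exact (hN ⟨h1, h2⟩).elim
      rw [h3.1, h3.2]
      simp [unipotentMatrix_self]
  simp only [hconst, Fintype.expect_const]

theorem expect_lamElt_act_eq_prod [Fintype (UT n K)] (θ : AddChar F ℂ)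
    (η ν : TwistedSetPartition n F K) :
    𝔼 g : UT n K, θ (lamElt η (act n F K g (xElt ν))) =
      ∏ p ∈ η.arcs ×ˢ ν.arcs with srcPair p ≤ srcPair (mirrorPair F p),
        𝔼 w : AboveDiag n → K, θ (pairForm p (unipotentMatrix w p.1.src p.2.src)
          (unipotentMatrix w p.1.tgt.rev p.2.tgt.rev)) := by
  classical
  rw [← Fintype.expect_equiv equivUT (fun w => ∏ p ∈ η.arcs ×ˢ ν.arcs with
    srcPair p ≤ srcPair (mirrorPair F p), θ (pairForm p (unipotentMatrix w p.1.src p.2.src)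
          (unipotentMatrix w p.1.tgt.rev p.2.tgt.rev)))]
  · refine expect_prod_of_dependsOn _ (fun p =>
      {e | e.1 = (p.1.src, p.2.src)} ∪ {e | e.1 = (p.1.tgt.rev, p.2.tgt.rev)}) ?_ _ ?_
    · intro p hp p' hp' hne
      simp only [Finset.coe_filter, Set.mem_ofPred_eq] at hp hp'
      rw [Function.onFun, Set.disjoint_left]
      have hinj := injOn_srcPair η ν
      have h1 : srcPair p ≠ srcPair p' := fun h => hne (hinj hp.1 hp'.1 h)
      have h2 : srcPair (mirrorPair F p) ≠ srcPair (mirrorPair F p') := fun h => by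
        apply hne
        rw [← mirrorPair_mirrorPair (F := F) p,
          hinj (mirrorPair_mem hp.1) (mirrorPair_mem hp'.1) h, mirrorPair_mirrorPair]
      -- If `p` were the mirror image of `p'`, both being minimal in their orbit would give them
      -- equal keys.
      have h3 : srcPair p ≠ srcPair (mirrorPair F p') := fun h => by
        have h4 := hinj hp.1 (mirrorPair_mem hp'.1) h
        refine h1 (le_antisymm ?_ (h ▸ hp'.2))
        have := hp.2
        rwa [h4, mirrorPair_mirrorPair, ← h4] at this
      have h4 : srcPair (mirrorPair F p) ≠ srcPair p' := fun h => by
        have h4 := hinj (mirrorPair_mem hp.1) hp'.1 h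
        refine h1 (le_antisymm (h ▸ hp.2) ?_)
        have := hp'.2
        rwa [← h4, mirrorPair_mirrorPair, h4] at this
      rintro e (he | he) (he' | he') <;> rw [Set.mem_ofPred_eq] at he he' <;> rw [he] at he'
      · exact h1 (congrArg toLex he')
      · exact h3 (congrArg toLex he')
      · exact h4 (congrArg toLex he')
      · exact h2 (congrArg toLex he')
    · intro p _ w w' h
      have h1 : unipotentMatrix w p.1.src p.2.src = unipotentMatrix w' p.1.src p.2.src :=
        dependsOn_unipotentMatrix _ _ fun e he => h e (Or.inl he)
      have h2 : unipotentMatrix w p.1.tgt.rev p.2.tgt.rev =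
          unipotentMatrix w' p.1.tgt.rev p.2.tgt.rev :=
        dependsOn_unipotentMatrix _ _ fun e he => h e (Or.inr he)
      simp only [h1, h2]
  · intro w
    rw [lamElt_act, map_sum_eq_prod, coe_equivUT]

theorem expect_lamElt_act_eq_zero [Fintype (UT n K)] (hθ : θ ≠ 1) {p : Arc n K × Arc n K}
    (hp : p ∈ η.arcs ×ˢ ν.arcs) (h : SharesEnd p) :
    𝔼 g : UT n K, θ (lamElt η (act n F K g (xElt ν))) = 0 := by
  rw [expect_lamElt_act_eq_prod]
  -- The vanishing factor is indexed by whichever of `p` and its mirror image represents the orbit.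
  rcases le_total (srcPair p) (srcPair (mirrorPair F p)) with hle | hle
  · exact Finset.prod_eq_zero (Finset.mem_filter.2 ⟨hp, hle⟩)
      (expect_pairForm_of_sharesEnd hθ hp h)
  · refine Finset.prod_eq_zero (Finset.mem_filter.2 ⟨mirrorPair_mem (F := F) hp, ?_⟩)
      (expect_pairForm_of_sharesEnd hθ (mirrorPair_mem hp) ((sharesEnd_mirrorPair p).2 h))
    rwa [mirrorPair_mirrorPair]

theorem sum_nestedCount (η ν : TwistedSetPartition n F K) :
    ∑ p ∈ η.arcs ×ˢ ν.arcs with srcPair p ≤ srcPair (mirrorPair F p), nestedCount F p =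
      nst η ν := by
  classical
  have h := sum_eq_sum_filter_key_le (η.arcs ×ˢ ν.arcs) (mirrorPair F) srcPair
    (fun p hp => mirrorPair_mem hp) (fun p _ => mirrorPair_mirrorPair p) (injOn_srcPair η ν)
    fun p => if Nested p then 1 else 0
  rw [nst, Finset.card_filter]
  simp only [nestedCount]
  rw [← h]
  exact Finset.sum_congr rfl fun p _ => if_congr Iff.rfl rfl rfl

theorem expect_lamElt_act [Fintype (UT n K)] (hθ : θ ≠ 1)
    (h : ∀ p ∈ η.arcs ×ˢ ν.arcs, ¬ SharesEnd p) :
    𝔼 g : UT n K, θ (lamElt η (act n F K g (xElt ν))) =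
      θ (lamElt η (xElt ν)) / (-(Fintype.card F : ℂ)) ^ nst η ν := by
  rw [expect_lamElt_act_eq_prod, Finset.prod_congr rfl fun p hp =>
    expect_pairForm_of_not_sharesEnd hθ (Finset.mem_filter.1 hp).1 (h p (Finset.mem_filter.1 hp).1),
    Finset.prod_mul_distrib, Finset.prod_pow_eq_pow_sum, sum_nestedCount, ← map_sum_eq_prod]
  -- At `g = 1` the orbit expansion is that of `λ_η(x_ν)` itself.
  have h1 := lamElt_act η ν 1
  rw [map_one, Module.End.one_apply] at h1
  rw [h1, inv_pow, div_eq_inv_mul]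
  rfl

end Averages

/-! ### From orbit sums to averages over the group. -/

section Supercharacters

variable {n : ℕ} {F K : Type*} [Field F] [Fintype F] [Field K] [Algebra F K]
  [Algebra.IsQuadraticExtension F K]

/-- The fibers of `g ↦ g · λ` over the orbit are cosets of the stabilizer, hence all of the same
size. -/
theorem finsum_orbitUT [Fintype (UT n K)] (lam : Module.Dual F (uu n F K))
    (φ : Module.Dual F (uu n F K) → ℂ) :
    ∑ᶠ μ ∈ orbitUT lam, φ μ =
      (orbitUT lam).ncard * 𝔼 g : UT n K, φ ((act n F K).dual g lam) := by
  classical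
  have horb : orbitUT lam =
      ↑(Finset.univ.image fun g : UT n K => (act n F K).dual g lam) := by
    ext μ
    simp [orbitUT]
  rw [horb, finsum_mem_coe_finset, Set.ncard_coe_finset]
  set m := (Finset.univ.filter fun g : UT n K => (act n F K).dual g lam = lam).card with hm
  have hfib : ∀ ψ : Module.Dual F (uu n F K) → ℂ, ∑ g : UT n K, ψ ((act n F K).dual g lam) =
      m * ∑ μ ∈ Finset.univ.image fun g : UT n K => (act n F K).dual g lam, ψ μ := by
    intro ψ
    rw [Finset.sum_comp ψ, Finset.mul_sum]
    refine Finset.sum_congr rfl fun μ hμ => ?_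
    obtain ⟨g₀, -, rfl⟩ := Finset.mem_image.1 hμ
    rw [nsmul_eq_mul]
    congr 2
    refine Finset.card_equiv (Equiv.mulLeft g₀⁻¹) fun g => ?_
    have hinv : (act n F K).dual g₀⁻¹ ((act n F K).dual g₀ lam) = lam := by
      rw [← Module.End.mul_apply, ← map_mul, inv_mul_cancel, map_one, Module.End.one_apply]
    have hinv' : ∀ μ, (act n F K).dual g₀ ((act n F K).dual g₀⁻¹ μ) = μ := fun μ => by
      rw [← Module.End.mul_apply, ← map_mul, mul_inv_cancel, map_one, Module.End.one_apply]
    simp only [Finset.mem_filter, Finset.mem_univ, true_and, Equiv.coe_mulLeft, map_mul,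
      Module.End.mul_apply]
    constructor
    · intro h; rw [h, hinv]
    · intro h; rw [← hinv' ((act n F K).dual g lam), h]
  have h1 := hfib fun _ => 1
  have h2 := hfib φ
  simp only [Finset.sum_const, Finset.card_univ, nsmul_eq_mul, mul_one] at h1
  have hcard : (Fintype.card (UT n K) : ℂ) ≠ 0 := by simp
  rw [Fintype.expect_eq_sum_div_card, h2, h1]
  rw [h1] at hcard
  rw [mul_div_mul_left _ _ (left_ne_zero_of_mul hcard),
    mul_div_cancel₀ _ (right_ne_zero_of_mul hcard)]

theorem SpringerMorphism.restrict_one (f : SpringerMorphism n F K) : f.restrict 1 = 0 := by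
  apply Subtype.ext
  obtain ⟨a, ha⟩ := f.exists_coeff
  have h := ha 1
  rw [Subgroup.coe_one, Units.val_one, sub_self, zero_add, Finset.sum_eq_zero] at h
  · exact h
  · intro i hi
    rw [zero_pow (by have := (Finset.mem_Icc.1 hi).1; omega), smul_zero]

/-- Since `f(1) = 0`, the value at `1` is `|H · λ|`, which is what the normalization leaves in front
of the average. Substituting `g⁻¹` for `g` removes the inverse in the dual action. -/
theorem supercharacter_eq [Fintype (UT n K)] (f : SpringerMorphism n F K) (θ : AddChar F ℂ)
    (lam : Module.Dual F (uu n F K)) (u : UU n F K) :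
    supercharacter f θ lam u = supercharacter f θ lam 1 *
      𝔼 g : UT n K, θ (lam (act n F K g (f.restrict u))) := by
  have h : 𝔼 g : UT n K, θ ((act n F K).dual g lam (f.restrict u)) =
      𝔼 g : UT n K, θ (lam (act n F K g (f.restrict u))) :=
    Fintype.expect_equiv (Equiv.inv _) _ _ fun g => rfl
  have h1 := finsum_orbitUT lam fun _ => 1
  rw [Fintype.expect_const, mul_one] at h1
  simp only [supercharacter, finsum_orbitUT lam fun μ => θ (μ _), h, f.restrict_one, map_zero,
    AddChar.map_zero_eq_one, h1]
  ring

end Supercharacters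

end UnipotentUnitary

theorem mainTheorem3 {F K : Type*} [Field F] [Fintype F] [Field K] [Algebra F K]
    [Algebra.IsQuadraticExtension F K] (q : ℕ) (hq : Fintype.card F = q) (hodd : Odd q)
    (n : ℕ) (f : UnipotentUnitary.SpringerMorphism n F K) (θ : AddChar F ℂ) (hθ : θ ≠ 1)
    (η ν : UnipotentUnitary.TwistedSetPartition n F K) :
    ∃ c : F, algebraMap F K c = UnipotentUnitary.commonArcSum η ν ∧
      ((∀ i j k : Fin n, η.HasArc i j → i < k → k < j → ¬ ν.HasArc i k ∧ ¬ ν.HasArc k j) →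
        UnipotentUnitary.chi f θ η (UnipotentUnitary.uElt f ν) =
          UnipotentUnitary.chi f θ η 1 / (-(q : ℂ)) ^ UnipotentUnitary.nst η ν * θ c) ∧
      ((¬ ∀ i j k : Fin n, η.HasArc i j → i < k → k < j → ¬ ν.HasArc i k ∧ ¬ ν.HasArc k j) →
        UnipotentUnitary.chi f θ η (UnipotentUnitary.uElt f ν) = 0) := by
  classical
  have : Finite K := Module.finite_of_finite F
  have : Fintype K := Fintype.ofFinite K
  have : Fintype (UnipotentUnitary.UT n K) := Fintype.ofEquiv _ UnipotentUnitary.equivUT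
  refine ⟨UnipotentUnitary.lamElt η (UnipotentUnitary.xElt ν),
    UnipotentUnitary.algebraMap_lamElt_xElt η ν, fun h => ?_, fun h => ?_⟩
  · rw [UnipotentUnitary.chi, UnipotentUnitary.supercharacter_eq, UnipotentUnitary.uElt,
      f.restrict_preimage, UnipotentUnitary.expect_lamElt_act hθ, hq]
    · ring
    · rintro ⟨⟨i, j, a⟩, ⟨k, l, b⟩⟩ hp hs
      rw [Finset.mem_product] at hp
      have hkl : k < l := ν.src_lt_tgt _ hp.2
      rcases hs with ⟨h1, h2⟩ | ⟨h1, h2⟩ <;> dsimp only at h1 h2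
      · subst h1
        exact (h i j l ⟨a, hp.1⟩ hkl h2).1 ⟨b, hp.2⟩
      · subst h2
        exact (h i l k ⟨a, hp.1⟩ h1 hkl).2 ⟨b, hp.2⟩
  · rw [UnipotentUnitary.chi, UnipotentUnitary.supercharacter_eq, UnipotentUnitary.uElt,
      f.restrict_preimage]
    simp only [not_forall, not_and_or, not_not] at h
    obtain ⟨i, j, k, ⟨a, ha⟩, hik, hkj, ⟨b, hb⟩ | ⟨b, hb⟩⟩ := h
    · rw [UnipotentUnitary.expect_lamElt_act_eq_zero hθ (Finset.mk_mem_product ha hb)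
        (Or.inl ⟨rfl, hkj⟩), mul_zero]
    · rw [UnipotentUnitary.expect_lamElt_act_eq_zero hθ (Finset.mk_mem_product ha hb)
        (Or.inr ⟨hik, rfl⟩), mul_zero]
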